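/- There is an absolute constant $k \in \mathbb{N}$ such that for every $\varepsilon_0 > 0$ there is a constant $C > 0$, depending only on $\varepsilon_0$, for which the following holds. Let $0 < \varepsilon \le \varepsilon_0$, $\gamma, \delta \in (0, 1/2)$, and let $\Delta \ge 1$ and $n \ge 1$ be integers. Suppose that each of $n$ users holds an input in $\{0, 1, \dots, \Delta\}$ and that the sum of the inputs is to be estimated. In the shuffle model, every user independently applies the same local randomizer to its input to obtain a random finite multiset of messages; the shuffler outputs a uniformly random permutation of all messages of all users; the analyzer computes an estimate from this sequence. There is such a protocol, with a randomizer that may depend on $n, \Delta, \varepsilon, \delta, \gamma$, with the following properties. 1. (Privacy) The output of the shuffler is $(\varepsilon, \delta)$-differentially private: if $V(x)$ denotes the output of the shuffler on the dataset $x$, then for all datasets $x, x' \in \{0, \dots, \Delta\}^n$ that differ in at most one user's input and for every set $S$ of outputs, $\Pr[V(x) \in S] \le e^{\varepsilon} \Pr[V(x') \in S] + \delta$. 2. (Error) On every dataset, the mean squared error of the estimate is at most that of the Discrete Laplace mechanism with parameter $s = (1-\gamma)\varepsilon/\Delta$, which adds to the true sum a random integer that takes each value $j \in \mathbb{Z}$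 with probability $\frac{1 - e^{-s}}{1 + e^{-s}} e^{-s|j|}$. 3. (Communication) Whatever its input, each user sends in expectation at most $$1 + C \, (1 + \log \Delta)^k \cdot \frac{\Delta \log(1/\delta)}{\gamma \varepsilon n}$$ messages, and each message is a string of $\lceil \log_2 \Delta \rceil + 1$ bits. -/

import Mathlib

open scoped ENNReal

noncomputable section

/-- Two datasets of `n` users are neighboring if they differ on at most one user's input. -/
def Neighboring {n : ℕ} {α : Type*} [DecidableEq α] (x x' : Fin n → α) : Prop :=
  (Finset.univ.filter fun i => x i ≠ x' i).card ≤ 1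

/-- `(ε, δ)`-differential privacy of a randomized algorithm on datasets of `n` users. -/
def IsDP {n : ℕ} {α Ω : Type*} [DecidableEq α] (A : (Fin n → α) → PMF Ω) (ε δ : ℝ) : Prop :=
  ∀ x x' : Fin n → α, Neighboring x x' → ∀ S : Set Ω,
    (A x).toOuterMeasure S ≤
      ENNReal.ofReal (Real.exp ε) * (A x').toOuterMeasure S + ENNReal.ofReal δ

/-- The multiset of all messages of `n` users, where user `i` sends, independently of the other
users, a random multiset of messages distributed as `p i`. -/
def collect {M : Type*} : (n : ℕ) → (Fin n → PMF (Multiset M)) → PMF (Multiset M)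
  | 0, _ => PMF.pure 0
  | n + 1, p => (p 0).bind fun s => (collect n fun i => p i.succ).map fun t => s + t

/-- The shuffler: a uniformly random permutation of the messages in the multiset `s`. -/
def shuffle {M : Type*} (s : Multiset M) : PMF (List M) :=
  PMF.ofMultiset (s.toList.permutations : Multiset (List M)) (by
    intro h
    have h' : s.toList.permutations = [] := by simpa using h
    have := List.length_permutations s.toList
    rw [h'] at this
    exact (Nat.factorial_pos _).ne this)

/-- A protocol in the (multi-message) shuffle model with inputs in `α`, messages in `M` and real
output: a local randomizer, which every user runs on its own input, and an analyzer, which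
receives the shuffled sequence of all messages. -/
structure ShuffleProtocol (α M : Type*) where
  randomizer : α → PMF (Multiset M)
  analyzer : List M → ℝ

namespace ShuffleProtocol

variable {α M : Type*}

/-- The output of the shuffler on the dataset `x`. -/
def view (P : ShuffleProtocol α M) {n : ℕ} (x : Fin n → α) : PMF (List M) :=
  (collect n fun i => P.randomizer (x i)).bind shuffle

/-- The output of the protocol on the dataset `x`. -/
def output (P : ShuffleProtocol α M) {n : ℕ} (x : Fin n → α) : PMF ℝ :=
  (P.view x).map P.analyzer

/-- The expected number of messages that a user with input `a` sends. -/
def expectedMessages (P : ShuffleProtocol α M) (a : α) : ℝ≥0∞ :=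
  ∑' s : Multiset M, P.randomizer a s * (s.card : ℝ≥0∞)

end ShuffleProtocol

/-- The sum of the inputs, each of which is in `{0, ..., Δ}`. -/
def trueSum {Δ n : ℕ} (x : Fin n → Fin (Δ + 1)) : ℤ :=
  ∑ i, ((x i : ℕ) : ℤ)

/-- The mean squared error `𝔼[(Y - t)²]` of an estimate `Y ~ p` of the number `t`. -/
def meanSquaredError (p : PMF ℝ) (t : ℝ) : ℝ≥0∞ :=
  ∑' y : ℝ, p y * ENNReal.ofReal ((y - t) ^ 2)

theorem hasSum_discreteLaplace (s : ℝ) (hs : 0 < s) :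
    HasSum (fun k : ℤ => (1 - Real.exp (-s)) / (1 + Real.exp (-s)) * Real.exp (-s * |(k : ℝ)|))
      1 := by
  set q := Real.exp (-s) with hq
  have hq0 : 0 < q := Real.exp_pos _
  have hq1 : q < 1 := by rw [hq, Real.exp_lt_one_iff]; linarith
  have hpow : ∀ m : ℕ, Real.exp (-s * m) = q ^ m := by
    intro m
    rw [hq, ← Real.exp_nat_mul]; ring_nf
  have hg := hasSum_geometric_of_lt_one hq0.le hq1
  have h1 : HasSum (fun n : ℕ => Real.exp (-s * |(((n : ℕ) : ℤ) : ℝ)|)) (1 - q)⁻¹ := by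
    refine hg.congr_fun ?_
    intro m
    have : |(((m : ℕ) : ℤ) : ℝ)| = (m : ℝ) := by simp
    rw [this, hpow]
  have h2 : HasSum (fun n : ℕ => Real.exp (-s * |((-((n : ℤ) + 1) : ℤ) : ℝ)|)) (q * (1 - q)⁻¹) := by
    refine (hg.mul_left q).congr_fun ?_
    intro m
    have : |((-((m : ℤ) + 1) : ℤ) : ℝ)| = ((m + 1 : ℕ) : ℝ) := by
      push_cast
      rw [abs_neg, abs_of_nonneg (by positivity)]
    rw [this, hpow, pow_succ']
  have h3 := (HasSum.of_nat_of_neg_add_one (f := fun k : ℤ => Real.exp (-s * |(k : ℝ)|)) h1 h2).mul_left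
    ((1 - q) / (1 + q))
  have h4 : (1 - q) / (1 + q) * ((1 - q)⁻¹ + q * (1 - q)⁻¹) = 1 := by
    have : 1 - q ≠ 0 := by linarith
    have : 1 + q ≠ 0 := by linarith
    field_simp
  rwa [h4] at h3

/-- The Discrete Laplace distribution with parameter `s > 0`. -/
def discreteLaplace (s : ℝ) (hs : 0 < s) : PMF ℤ :=
  ⟨fun k => ENNReal.ofReal
      ((1 - Real.exp (-s)) / (1 + Real.exp (-s)) * Real.exp (-s * |(k : ℝ)|)), by
    have h := hasSum_discreteLaplace s hs
    have hq1 : Real.exp (-s) < 1 := by rw [Real.exp_lt_one_iff]; linarith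
    have hnn : ∀ k : ℤ, 0 ≤ (1 - Real.exp (-s)) / (1 + Real.exp (-s)) *
        Real.exp (-s * |(k : ℝ)|) := fun k =>
      mul_nonneg (div_nonneg (by linarith) (by positivity)) (Real.exp_pos _).le
    have h' := ENNReal.ofReal_tsum_of_nonneg hnn h.summable
    rw [h.tsum_eq, ENNReal.ofReal_one] at h'
    rw [h']
    exact ENNReal.summable.hasSum⟩

/-- The Discrete Laplace mechanism: the true sum plus Discrete Laplace noise. -/
def discreteLaplaceMechanism (s : ℝ) (hs : 0 < s) {Δ n : ℕ} (x : Fin n → Fin (Δ + 1)) : PMF ℝ :=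
  (discreteLaplace s hs).map fun z => ((trueSum x + z : ℤ) : ℝ)

theorem param_pos {ε γ : ℝ} {Δ : ℕ} (hε : 0 < ε) (hγ : γ < 1 / 2) (hΔ : 1 ≤ Δ) :
    0 < (1 - γ) * ε / (Δ : ℝ) := by
  have h1 : 0 < 1 - γ := by linarith
  have h2 : (0 : ℝ) < Δ := by exact_mod_cast hΔ
  positivity

end

/-! Every user sends its input and a share of noise. Negative binomial laws are infinitely
divisible, so the shares add up to noise drawn once. Its central part is a geometric number of
messages `1` and of messages `-1`, whose difference is exactly Discrete Laplace. The rest floods the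
output with random numbers of copies of fixed multisets of sum zero, which hide the messages but
leave the estimate unchanged. The error therefore equals that of the Discrete Laplace mechanism.

For privacy, an input `x` is turned into `y` by adding and removing a few flooding multisets and at
most `Δ` central messages (`inputMessage_exchange`). The central messages cost `Δ * s = (1 - γ) *
ε`. A shift of a negative binomial by one costs a multiple of `a`, and in one direction also `exp
(-r)` in `δ` (`pure_one_mul_negBinomial_approxLE`, `negBinomial_approxLE_pure_one_mul`). An exchange
touches `O(log Δ)` multisets, so `a` of order `γ * ε / log Δ` and `r` of order `log Δ + log (1 / δ)`
suffice.

Cancelling each `x` against `x` messages `-1` would need multisets of total size `Δ ^ 2`. Passing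
through the binary digits of `x` reduces this to `O(Δ log Δ)`, and the flooding to `O(Δ log Δ * r /
a)` messages in total. -/

open scoped NNReal

noncomputable section

/-! ### Expectations and the convolution monoid of probability mass functions. -/

namespace PMF

variable {A B : Type*}

/-- The expectation of a nonnegative function under a probability mass function. -/
def expect (p : PMF A) (f : A → ℝ≥0∞) : ℝ≥0∞ := ∑' a, p a * f a

@[simp]
theorem expect_pure (a : A) (f : A → ℝ≥0∞) : (pure a).expect f = f a := by
  classical
  rw [expect, tsum_eq_single a]
  · simp
  · intro b hb
    simp [pure_apply, hb]

@[simp]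
theorem expect_bind (p : PMF A) (q : A → PMF B) (f : B → ℝ≥0∞) :
    (p.bind q).expect f = p.expect fun a => (q a).expect f := by
  simp only [expect, bind_apply, ← ENNReal.tsum_mul_right, ← ENNReal.tsum_mul_left, mul_assoc]
  exact ENNReal.tsum_comm

@[simp]
theorem expect_map (p : PMF A) (g : A → B) (f : B → ℝ≥0∞) :
    (p.map g).expect f = p.expect fun a => f (g a) := by
  rw [← bind_pure_comp, expect_bind]
  simp

@[simp]
theorem expect_const (p : PMF A) (c : ℝ≥0∞) : (p.expect fun _ => c) = c := by
  rw [expect, ENNReal.tsum_mul_right, tsum_coe, one_mul]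

theorem expect_add (p : PMF A) (f g : A → ℝ≥0∞) :
    (p.expect fun a => f a + g a) = p.expect f + p.expect g := by
  simp only [expect, mul_add, ENNReal.tsum_add]

theorem expect_const_mul (p : PMF A) (c : ℝ≥0∞) (f : A → ℝ≥0∞) :
    (p.expect fun a => c * f a) = c * p.expect f := by
  simp only [expect, mul_left_comm _ c, ENNReal.tsum_mul_left]

theorem expect_mono (p : PMF A) {f g : A → ℝ≥0∞} (h : ∀ a, f a ≤ g a) :
    p.expect f ≤ p.expect g :=
  ENNReal.tsum_le_tsum fun a => mul_le_mul_right (h a) _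

theorem expect_le_one (p : PMF A) {f : A → ℝ≥0∞} (h : ∀ a, f a ≤ 1) : p.expect f ≤ 1 :=
  (p.expect_mono h).trans (by simp)

theorem expect_comm (p : PMF A) (q : PMF B) (f : A → B → ℝ≥0∞) :
    (p.expect fun a => q.expect fun b => f a b) = q.expect fun b => p.expect fun a => f a b := by
  simp only [expect, ← ENNReal.tsum_mul_left]
  rw [ENNReal.tsum_comm]
  simp only [mul_left_comm]

theorem ext_expect {p q : PMF A} (h : ∀ f, p.expect f = q.expect f) : p = q := by
  classical
  have key : ∀ (r : PMF A) (a : A), (r.expect fun b => if b = a then 1 else 0) = r a := by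
    intro r a
    rw [expect, tsum_eq_single a]
    · simp
    · intro b hb
      simp [hb]
  ext a
  rw [← key p, ← key q, h]

section Convolution

variable [AddCommMonoid A] [AddCommMonoid B]

/-- Probability mass functions on a commutative monoid form a commutative monoid under
convolution. -/
instance : CommMonoid (PMF A) where
  mul p q := p.bind fun a => q.map (a + ·)
  one := pure 0
  mul_assoc p q r := ext_expect fun f => by
    change ((p.bind fun a => q.map (a + ·)).bind fun a => r.map (a + ·)).expect f =
      (p.bind fun a => (q.bind fun a => r.map (a + ·)).map (a + ·)).expect f
    simp [add_assoc]
  one_mul p := ext_expect fun f => by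
    change ((pure (0 : A)).bind fun a => p.map (a + ·)).expect f = _
    simp
  mul_one p := ext_expect fun f => by
    change (p.bind fun a => (pure (0 : A)).map (a + ·)).expect f = _
    simp
  mul_comm p q := ext_expect fun f => by
    change (p.bind fun a => q.map (a + ·)).expect f = (q.bind fun a => p.map (a + ·)).expect f
    simp only [expect_bind, expect_map]
    rw [expect_comm]
    simp only [add_comm]

theorem mul_def (p q : PMF A) : p * q = p.bind fun a => q.map (a + ·) := rfl

theorem one_def : (1 : PMF A) = pure 0 := rfl

@[simp]
theorem expect_mul (p q : PMF A) (f : A → ℝ≥0∞) :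
    (p * q).expect f = p.expect fun a => q.expect fun b => f (a + b) := by
  simp [mul_def]

/-- The pushforward along an additive homomorphism respects convolution. -/
def mapHom (h : A →+ B) : PMF A →* PMF B where
  toFun p := p.map h
  map_one' := ext_expect fun f => by simp [one_def]
  map_mul' p q := ext_expect fun f => by simp

@[simp]
theorem mapHom_apply (h : A →+ B) (p : PMF A) : mapHom h p = p.map h := rfl

/-- Point masses as a homomorphism to the convolution monoid. -/
def pureHom : Multiplicative A →* PMF A where
  toFun a := pure a.toAdd
  map_one' := rfl
  map_mul' a b := ext_expect fun f => by simp

theorem pure_add (a b : A) : pure (a + b) = pure a * pure b :=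
  pureHom.map_mul (Multiplicative.ofAdd a) (Multiplicative.ofAdd b)

theorem pure_sum {ι : Type*} (s : Finset ι) (f : ι → A) :
    pure (∑ i ∈ s, f i) = ∏ i ∈ s, pure (f i) := by
  classical
  induction s using Finset.induction_on with
  | empty => rfl
  | insert i s hi ih => rw [Finset.sum_insert hi, Finset.prod_insert hi, pure_add, ih]

theorem expect_mul_addHom (p q : PMF A) (h : A → ℝ≥0∞) (hh : ∀ a b, h (a + b) = h a + h b) :
    (p * q).expect h = p.expect h + q.expect h := by
  simp [hh, expect_add]

theorem expect_prod_addHom {ι : Type*} (s : Finset ι) (p : ι → PMF A) (h : A → ℝ≥0∞)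
    (h0 : h 0 = 0) (hh : ∀ a b, h (a + b) = h a + h b) :
    (∏ i ∈ s, p i).expect h = ∑ i ∈ s, (p i).expect h := by
  classical
  induction s using Finset.induction_on with
  | empty => simp [one_def, h0]
  | insert i s hi ih =>
    rw [Finset.sum_insert hi, Finset.prod_insert hi, expect_mul_addHom _ _ _ hh, ih]

end Convolution

/-! ### Approximate domination, its composition and post-processing. -/

/-- `p.ApproxLE ε δ q` says that `p` is at most `e ^ ε * q + δ` on all events; for technical
convenience it is stated for all tests with values in `[0, 1]`. -/
def ApproxLE (ε δ : ℝ) (p q : PMF A) : Prop :=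
  ∀ f : A → ℝ≥0∞, (∀ a, f a ≤ 1) →
    p.expect f ≤ ENNReal.ofReal (Real.exp ε) * q.expect f + ENNReal.ofReal δ

theorem approxLE_refl {ε δ : ℝ} (hε : 0 ≤ ε) (p : PMF A) : ApproxLE ε δ p p := by
  intro f _
  refine le_add_right ?_
  calc p.expect f = ENNReal.ofReal 1 * p.expect f := by simp
    _ ≤ _ := by gcongr; exact Real.one_le_exp hε

theorem ApproxLE.mono {ε δ ε' δ' : ℝ} {p q : PMF A} (h : ApproxLE ε δ p q) (hε : ε ≤ ε')
    (hδ : δ ≤ δ') : ApproxLE ε' δ' p q := by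
  intro f hf
  refine (h f hf).trans ?_
  gcongr

theorem ApproxLE.trans {ε₁ δ₁ ε₂ δ₂ : ℝ} {p q r : PMF A} (h₁ : ApproxLE ε₁ δ₁ p q)
    (h₂ : ApproxLE ε₂ δ₂ q r) (hδ₁ : 0 ≤ δ₁) (hδ₂ : 0 ≤ δ₂) :
    ApproxLE (ε₁ + ε₂) (Real.exp ε₁ * δ₂ + δ₁) p r := by
  intro f hf
  calc p.expect f ≤ ENNReal.ofReal (Real.exp ε₁) * q.expect f + ENNReal.ofReal δ₁ := h₁ f hf
    _ ≤ ENNReal.ofReal (Real.exp ε₁) *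
        (ENNReal.ofReal (Real.exp ε₂) * r.expect f + ENNReal.ofReal δ₂) + ENNReal.ofReal δ₁ := by
      gcongr
      exact h₂ f hf
    _ = _ := by
      rw [mul_add, ← mul_assoc, ← ENNReal.ofReal_mul (Real.exp_pos _).le, ← Real.exp_add,
        ENNReal.ofReal_add (by positivity) hδ₁, ENNReal.ofReal_mul (Real.exp_pos _).le, add_assoc]

/-- Averaging a test over the kernel gives another `[0, 1]`-valued test, though in general not the
indicator of an event. This is what the formulation with tests is for. -/
theorem ApproxLE.bind {ε δ : ℝ} {p q : PMF A} (h : ApproxLE ε δ p q) (k : A → PMF B) :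
    ApproxLE ε δ (p.bind k) (q.bind k) := by
  intro f hf
  simpa using h (fun a => (k a).expect f) fun a => expect_le_one _ hf

theorem ApproxLE.map {ε δ : ℝ} {p q : PMF A} (h : ApproxLE ε δ p q) (k : A → B) :
    ApproxLE ε δ (p.map k) (q.map k) := by
  intro f hf
  simpa using h (fun a => f (k a)) fun a => hf _

theorem ApproxLE.toOuterMeasure_le {ε δ : ℝ} {p q : PMF A} (h : ApproxLE ε δ p q) (S : Set A) :
    p.toOuterMeasure S ≤
      ENNReal.ofReal (Real.exp ε) * q.toOuterMeasure S + ENNReal.ofReal δ := by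
  classical
  have key : ∀ r : PMF A, r.toOuterMeasure S = r.expect (S.indicator 1) := by
    intro r
    rw [toOuterMeasure_apply, expect]
    refine tsum_congr fun a => ?_
    by_cases ha : a ∈ S <;> simp [ha]
  rw [key, key]
  refine h _ fun a => ?_
  by_cases ha : a ∈ S <;> simp [ha]

section Convolution

variable [AddCommMonoid A]

theorem ApproxLE.mul_left {ε δ : ℝ} {p q : PMF A} (h : ApproxLE ε δ p q) (r : PMF A) :
    ApproxLE ε δ (r * p) (r * q) := by
  rw [mul_comm r, mul_comm r]
  exact h.bind _

/-- If a distribution is approximately invariant under the shift by each `S j`, then it is so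
under the shift by a sum of such terms. -/
theorem approxLE_pure_sum_mul {ι : Type*} {ε δ : ℝ} (hε : 0 ≤ ε) (hδ : 0 ≤ δ) {p : PMF A}
    (T : Finset ι) (S : ι → A) (h : ∀ j ∈ T, ApproxLE ε δ p (pure (S j) * p)) :
    ApproxLE (T.card * ε) (Real.exp (T.card * ε) * (T.card * δ)) p
      (pure (∑ j ∈ T, S j) * p) := by
  classical
  induction T using Finset.induction_on with
  | empty =>
    rw [Finset.sum_empty, ← one_def, one_mul]
    exact approxLE_refl (by simp) _
  | insert j T hj ih =>
    have h1 := ih fun i hi => h i (Finset.mem_insert_of_mem hi)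
    have h2 := (h1.trans ((h j (Finset.mem_insert_self _ _)).mul_left (pure (∑ i ∈ T, S i)))
      (by positivity) hδ)
    rw [Finset.card_insert_of_notMem hj, Finset.sum_insert hj, add_comm (S j), pure_add, mul_assoc]
    refine h2.mono (by push_cast; linarith) ?_
    push_cast
    rw [← mul_add]
    have : (δ + T.card * δ) = (T.card + 1) * δ := by ring
    rw [this]
    gcongr
    linarith

theorem pure_sum_mul_approxLE {ι : Type*} {ε : ℝ} {p : PMF A}
    (T : Finset ι) (S : ι → A) (h : ∀ j ∈ T, ApproxLE ε 0 (pure (S j) * p) p) :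
    ApproxLE (T.card * ε) 0 (pure (∑ j ∈ T, S j) * p) p := by
  classical
  induction T using Finset.induction_on with
  | empty =>
    rw [Finset.sum_empty, ← one_def, one_mul]
    exact approxLE_refl (by simp) _
  | insert j T hj ih =>
    have h1 := ih fun i hi => h i (Finset.mem_insert_of_mem hi)
    have h2 := (((h j (Finset.mem_insert_self _ _)).mul_left (pure (∑ i ∈ T, S i))).trans h1
      le_rfl le_rfl)
    rw [Finset.card_insert_of_notMem hj, Finset.sum_insert hj, add_comm (S j), pure_add, mul_assoc]
    exact h2.mono (by push_cast; linarith) (by simp)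

end Convolution

end PMF

theorem collect_eq_prod {M : Type*} (n : ℕ) (p : Fin n → PMF (Multiset M)) :
    collect n p = ∏ i, p i := by
  induction n with
  | zero => rfl
  | succ n ih => rw [Fin.prod_univ_succ, ← ih, PMF.mul_def]; rfl

/-! ### Coefficients of the binomial series with real exponent. -/

section Multichoose

theorem succ_mul_multichoose_succ (r : ℝ) (n : ℕ) :
    (n + 1 : ℝ) * Ring.multichoose r (n + 1) = (r + n) * Ring.multichoose r n := by
  have h1 := Ring.factorial_nsmul_multichoose_eq_ascPochhammer r (n + 1)
  have h0 := Ring.factorial_nsmul_multichoose_eq_ascPochhammer r n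
  rw [Polynomial.ascPochhammer_smeval_eq_eval, ascPochhammer_succ_eval,
    ← Polynomial.ascPochhammer_smeval_eq_eval, ← h0, Nat.factorial_succ] at h1
  simp only [nsmul_eq_mul, Nat.cast_mul] at h1
  have h2 : (n.factorial : ℝ) ≠ 0 := by positivity
  apply mul_left_cancel₀ h2
  push_cast at h1
  linarith

theorem multichoose_nonneg {r : ℝ} (hr : 0 ≤ r) (n : ℕ) : 0 ≤ Ring.multichoose r n := by
  induction n with
  | zero => simp
  | succ n ih =>
    have h := succ_mul_multichoose_succ r n
    have h2 : 0 ≤ (n + 1 : ℝ) * Ring.multichoose r (n + 1) := by rw [h]; positivity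
    exact nonneg_of_mul_nonneg_right h2 (by positivity)

/-- Vandermonde's identity for `Ring.choose` at `-r` and `-s`, with the signs `(-1) ^ n` cancelling.
-/
theorem multichoose_add (r s : ℝ) (n : ℕ) :
    Ring.multichoose (r + s) n =
      ∑ ij ∈ Finset.HasAntidiagonal.antidiagonal n,
        Ring.multichoose r ij.1 * Ring.multichoose s ij.2 := by
  have key : ∀ (t : ℝ) (m : ℕ), Ring.multichoose t m = (-1) ^ m * Ring.choose (-t) m := by
    intro t m
    rw [Ring.choose_neg, Ring.multichoose_eq, Units.smul_def, zsmul_eq_mul, ← mul_assoc]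
    simp [← pow_add, ← two_mul]
  rw [key, neg_add, Ring.add_choose_eq n (Commute.all _ _), Finset.mul_sum]
  refine Finset.sum_congr rfl fun ij h => ?_
  rw [key, key, ← Finset.HasAntidiagonal.mem_antidiagonal.mp h]
  ring

theorem hasSum_multichoose_mul_pow (r : ℝ) {q : ℝ} (hq0 : 0 ≤ q) (hq1 : q < 1) :
    HasSum (fun n : ℕ => Ring.multichoose r n * q ^ n) (((1 - q) ^ r)⁻¹) := by
  have h := (Real.one_div_one_sub_rpow_hasFPowerSeriesOnBall_zero r).hasSum (y := q) (by
    simp [enorm_eq_nnnorm, hq0, abs_of_nonneg, ← NNReal.coe_lt_coe, hq1])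
  simpa [Ring.multichoose_eq, mul_comm] using h

end Multichoose

/-! ### Negative binomial distributions and their behaviour under a shift by one. -/

namespace PMF

theorem one_sub_exp_neg_pos {a : ℝ} (ha : 0 < a) : 0 < 1 - Real.exp (-a) := by
  have : Real.exp (-a) < 1 := by rw [Real.exp_lt_one_iff]; linarith
  linarith

/-- The probabilities of the negative binomial distribution. -/
def negBinomialReal (r a : ℝ) (z : ℕ) : ℝ :=
  Ring.multichoose r z * Real.exp (-a) ^ z * (1 - Real.exp (-a)) ^ r

theorem negBinomialReal_nonneg {r a : ℝ} (hr : 0 ≤ r) (ha : 0 < a) (z : ℕ) :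
    0 ≤ negBinomialReal r a z := by
  have := one_sub_exp_neg_pos ha
  have := multichoose_nonneg hr z
  rw [negBinomialReal]
  positivity

theorem hasSum_negBinomialReal (r : ℝ) {a : ℝ} (ha : 0 < a) :
    HasSum (negBinomialReal r a) 1 := by
  have h0 := one_sub_exp_neg_pos ha
  have h := (hasSum_multichoose_mul_pow r (Real.exp_pos (-a)).le
    (by linarith)).mul_right ((1 - Real.exp (-a)) ^ r)
  rwa [inv_mul_cancel₀ (Real.rpow_pos_of_pos h0 r).ne'] at h

/-- The negative binomial distribution with real shape parameter `r` and ratio `exp (-a)`. -/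
def negBinomial (r : ℝ≥0) (a : ℝ) (ha : 0 < a) : PMF ℕ :=
  ⟨fun z => ENNReal.ofReal (negBinomialReal r a z), by
    have h := hasSum_negBinomialReal r ha
    exact ENNReal.summable.hasSum_iff.2
      ((ENNReal.ofReal_tsum_of_nonneg (negBinomialReal_nonneg r.2 ha) h.summable).symm.trans
        ((congrArg ENNReal.ofReal h.tsum_eq).trans ENNReal.ofReal_one))⟩

variable {a : ℝ} (ha : 0 < a)

theorem negBinomial_apply (r : ℝ≥0) (z : ℕ) :
    negBinomial r a ha z = ENNReal.ofReal (negBinomialReal r a z) := rfl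

/-- The ratio of consecutive probabilities, on which both shift comparisons rest. -/
theorem negBinomialReal_succ (r : ℝ) (z : ℕ) :
    (z + 1 : ℝ) * negBinomialReal r a (z + 1) =
      Real.exp (-a) * (r + z) * negBinomialReal r a z := by
  simp only [negBinomialReal, pow_succ]
  linear_combination
    (Real.exp (-a) ^ z * Real.exp (-a) * (1 - Real.exp (-a)) ^ r) * succ_mul_multichoose_succ r z

theorem expect_mul_nat (p q : PMF ℕ) (f : ℕ → ℝ≥0∞) :
    (p * q).expect f =
      ∑' n, (∑ ij ∈ Finset.HasAntidiagonal.antidiagonal n, p ij.1 * q ij.2) * f n := by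
  have h1 : (p * q).expect f = ∑' ij : ℕ × ℕ, p ij.1 * q ij.2 * f (ij.1 + ij.2) := by
    rw [expect_mul, ENNReal.tsum_prod']
    simp only [expect, ← ENNReal.tsum_mul_left, mul_assoc]
  rw [h1, ← (Finset.HasAntidiagonal.sigmaAntidiagonalEquivProd (A := ℕ)).tsum_eq
    fun ij : ℕ × ℕ => p ij.1 * q ij.2 * f (ij.1 + ij.2), ENNReal.tsum_sigma']
  refine tsum_congr fun n => ?_
  rw [tsum_fintype, Finset.sum_mul,
    ← Finset.sum_coe_sort (Finset.HasAntidiagonal.antidiagonal n) fun ij => p ij.1 * q ij.2 * f n]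
  refine Finset.sum_congr rfl fun ij _ => ?_
  have := Finset.HasAntidiagonal.mem_antidiagonal.mp ij.2
  simp [Finset.HasAntidiagonal.sigmaAntidiagonalEquivProd, this]

theorem negBinomial_add (r s : ℝ≥0) :
    negBinomial (r + s) a ha = negBinomial r a ha * negBinomial s a ha := by
  refine ext_expect fun f => ?_
  rw [expect_mul_nat, expect]
  refine tsum_congr fun n => ?_
  congr 1
  have h : ∀ ij ∈ Finset.HasAntidiagonal.antidiagonal n,
      negBinomial r a ha ij.1 * negBinomial s a ha ij.2 = ENNReal.ofReal (negBinomialReal r a ij.1 * negBinomialReal s a ij.2) := fun ij _ => by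
    exact (ENNReal.ofReal_mul (negBinomialReal_nonneg r.2 ha _)).symm
  rw [Finset.sum_congr rfl h, ← ENNReal.ofReal_sum_of_nonneg, negBinomial_apply]
  · congr 1
    simp only [negBinomialReal]
    push_cast
    rw [multichoose_add, Real.rpow_add (one_sub_exp_neg_pos ha), Finset.sum_mul, Finset.sum_mul]
    refine Finset.sum_congr rfl fun ij hij => ?_
    rw [← Finset.HasAntidiagonal.mem_antidiagonal.mp hij, pow_add]
    ring
  · intro ij _
    exact mul_nonneg (negBinomialReal_nonneg r.2 ha _) (negBinomialReal_nonneg s.2 ha _)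

theorem negBinomial_zero : negBinomial 0 a ha = 1 := by
  ext z
  rw [negBinomial_apply, one_def, pure_apply]
  cases z with
  | zero => simp [negBinomialReal]
  | succ z => simp [negBinomialReal]

/-- The negative binomial distribution is infinitely divisible. -/
theorem negBinomial_div_pow (r : ℝ≥0) {n : ℕ} (hn : 1 ≤ n) :
    negBinomial (r / n) a ha ^ n = negBinomial r a ha := by
  have key : ∀ m : ℕ, negBinomial (r / n) a ha ^ m = negBinomial (m * (r / n)) a ha := by
    intro m
    induction m with
    | zero => simp [negBinomial_zero]
    | succ m ih => rw [pow_succ, ih, ← negBinomial_add]; congr 1; push_cast; ring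
  rw [key]
  congr 1
  have : (n : ℝ≥0) ≠ 0 := by exact_mod_cast (by omega : n ≠ 0)
  field_simp

/-- The mean of the negative binomial distribution is at most `r / a`. -/
theorem expect_negBinomial_le (r : ℝ≥0) :
    (negBinomial r a ha).expect (fun z => (z : ℝ≥0∞)) ≤ ENNReal.ofReal (r / a) := by
  have h0 := one_sub_exp_neg_pos ha
  -- Size-biasing turns shape `r` into shape `r + 1`, so the mean is read off from a total mass of
  -- `1`.
  have hval : ∀ z : ℕ, ((z + 1 : ℕ) : ℝ) * negBinomialReal r a (z + 1) =
      r * (Real.exp (-a) / (1 - Real.exp (-a))) * negBinomialReal (r + 1) a z := by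
    intro z
    have hs : ∀ z : ℕ, (r : ℝ) * Ring.multichoose ((r : ℝ) + 1) z =
        (r + z) * Ring.multichoose (r : ℝ) z := by
      intro z
      induction z with
      | zero => simp
      | succ z ih =>
        have h1 := succ_mul_multichoose_succ (r : ℝ) z
        have h2 := succ_mul_multichoose_succ ((r : ℝ) + 1) z
        have h3 : (z + 1 : ℝ) ≠ 0 := by positivity
        apply mul_left_cancel₀ h3
        push_cast
        linear_combination r * h2 + (r + 1 + z) * ih - (r + (z + 1)) * h1
    push_cast
    rw [negBinomialReal_succ, negBinomialReal, negBinomialReal, Real.rpow_add_one h0.ne']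
    field_simp
    linear_combination -hs z
  have hsum := (hasSum_negBinomialReal (r + 1) ha).mul_left
    (r * (Real.exp (-a) / (1 - Real.exp (-a))))
  have hc : 0 ≤ r * (Real.exp (-a) / (1 - Real.exp (-a))) := by positivity
  have hE : (negBinomial r a ha).expect (fun z => (z : ℝ≥0∞)) =
      ENNReal.ofReal (r * (Real.exp (-a) / (1 - Real.exp (-a)))) := by
    rw [expect, tsum_eq_zero_add' ENNReal.summable, Nat.cast_zero, mul_zero, zero_add,
      ← mul_one (r * _ : ℝ), ← hsum.tsum_eq, ENNReal.ofReal_tsum_of_nonneg _ hsum.summable]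
    · refine tsum_congr fun z => ?_
      rw [← hval, negBinomial_apply, mul_comm, ENNReal.ofReal_mul (by positivity),
        ENNReal.ofReal_natCast]
    · intro z
      exact mul_nonneg hc (negBinomialReal_nonneg (by positivity) ha z)
  rw [hE]
  refine ENNReal.ofReal_le_ofReal ?_
  rw [div_eq_mul_inv (r : ℝ)]
  gcongr
  rw [div_le_iff₀ h0, inv_mul_eq_div, le_div_iff₀ ha]
  have h1 : Real.exp (-a) * (1 + a) ≤ 1 := by
    calc Real.exp (-a) * (1 + a) ≤ Real.exp (-a) * Real.exp a := by
          gcongr; linarith [Real.add_one_le_exp a]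
      _ = 1 := by rw [← Real.exp_add]; simp
  linarith

/-- A pointwise comparison outside of a set of small probability. -/
theorem approxLE_of_forall_le {A : Type*} {ε δ : ℝ} {p q : PMF A} (g : A → ℝ≥0∞)
    (hg : ∑' z, g z ≤ ENNReal.ofReal δ)
    (h : ∀ z, p z ≤ ENNReal.ofReal (Real.exp ε) * q z + g z) : ApproxLE ε δ p q := by
  intro f hf
  calc p.expect f ≤ ∑' z, (ENNReal.ofReal (Real.exp ε) * (q z * f z) + g z) := by
        refine ENNReal.tsum_le_tsum fun z => ?_
        calc p z * f z ≤ (ENNReal.ofReal (Real.exp ε) * q z + g z) * f z := by gcongr; exact h z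
          _ = ENNReal.ofReal (Real.exp ε) * (q z * f z) + g z * f z := by ring
          _ ≤ _ := by gcongr; exact mul_le_of_le_one_right' (hf z)
    _ = ENNReal.ofReal (Real.exp ε) * q.expect f + ∑' z, g z := by
        rw [ENNReal.tsum_add, ENNReal.tsum_mul_left, expect]
    _ ≤ _ := by gcongr

theorem pure_one_mul_apply_succ (p : PMF ℕ) (z : ℕ) : (pure 1 * p : PMF ℕ) (z + 1) = p z := by
  rw [mul_def, pure_bind, map_apply, tsum_eq_single z]
  · simp [add_comm]
  · intro b hb
    rw [if_neg]
    omega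

theorem pure_one_mul_apply_zero (p : PMF ℕ) : (pure 1 * p : PMF ℕ) 0 = 0 := by
  rw [mul_def, pure_bind, map_apply, ENNReal.tsum_eq_zero]
  intro b
  rw [if_neg]
  omega

/-- For `r ≥ 1`, consecutive probabilities drop by a factor of at most `exp a`, and the shifted law
has no mass at `0`; hence no `δ` is needed. -/
theorem pure_one_mul_negBinomial_approxLE {r : ℝ≥0} (hr : 1 ≤ r) :
    ApproxLE a 0 (pure 1 * negBinomial r a ha) (negBinomial r a ha) := by
  refine approxLE_of_forall_le (fun _ => 0) (by simp) fun z => ?_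
  cases z with
  | zero => simp [pure_one_mul_apply_zero]
  | succ z =>
    rw [pure_one_mul_apply_succ, add_zero, negBinomial_apply, negBinomial_apply,
      ← ENNReal.ofReal_mul (Real.exp_pos _).le]
    refine ENNReal.ofReal_le_ofReal ?_
    have h := negBinomialReal_succ (a := a) r z
    have h1 : (1 : ℝ) ≤ r := by exact_mod_cast hr
    have h2 := negBinomialReal_nonneg r.2 ha z
    have h3 : (z + 1 : ℝ) * negBinomialReal r a z ≤
        (z + 1 : ℝ) * (Real.exp a * negBinomialReal r a (z + 1)) := by
      rw [mul_left_comm, h]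
      have : Real.exp a * (Real.exp (-a) * (r + z) * negBinomialReal r a z) =
          (r + z) * negBinomialReal r a z := by
        rw [← mul_assoc, ← mul_assoc, ← Real.exp_add]; simp
      rw [this]
      gcongr ?_ * _
      linarith
    exact le_of_mul_le_mul_left h3 (by positivity)

/-- The ratio of consecutive probabilities is at most `exp (15 * a)` once `z ≥ r / (16 * a)`.
Smaller values are rare by exponential tilting: there the law is at most `exp (-r)` times the
negative binomial law with parameter `16 * a`, whose total mass is `1`. -/
theorem negBinomial_approxLE_pure_one_mul {r : ℝ≥0} (hr : 1 ≤ r) (ha' : 16 * a ≤ 1) :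
    ApproxLE (15 * a) (Real.exp (-r)) (negBinomial r a ha) (pure 1 * negBinomial r a ha) := by
  have ha16 : 0 < 16 * a := by positivity
  have hr1 : (1 : ℝ) ≤ r := by exact_mod_cast hr
  refine approxLE_of_forall_le
    (fun z => ENNReal.ofReal (Real.exp (-r)) * negBinomial r (16 * a) ha16 z)
    (by rw [ENNReal.tsum_mul_left, tsum_coe, mul_one]) fun z => ?_
  by_cases hz : 16 * a * z < r
  · refine le_add_left ?_
    rw [negBinomial_apply, negBinomial_apply, ← ENNReal.ofReal_mul (Real.exp_pos _).le]
    refine ENNReal.ofReal_le_ofReal ?_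
    have h0 := one_sub_exp_neg_pos ha
    have h16 := one_sub_exp_neg_pos ha16
    -- The factor `16` is large enough to gain `exp (-2)`: the left side is at most `a`, while `1 -
    -- exp (-16a) ≥ 8a` because `16a ≤ 1`, and `exp 2 ≤ 8`.
    have hratio : 1 - Real.exp (-a) ≤ Real.exp (-2) * (1 - Real.exp (-(16 * a))) := by
      have e1 : 1 - Real.exp (-a) ≤ a := by linarith [Real.add_one_le_exp (-a)]
      have e2 : 8 * a ≤ 1 - Real.exp (-(16 * a)) := by
        have h : Real.exp (-(16 * a)) * (1 + 16 * a) ≤ 1 := by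
          calc Real.exp (-(16 * a)) * (1 + 16 * a) ≤ Real.exp (-(16 * a)) * Real.exp (16 * a) := by
                gcongr; linarith [Real.add_one_le_exp (16 * a)]
            _ = 1 := by rw [← Real.exp_add]; simp
        have h' : Real.exp (-(16 * a)) ≤ 1 / (1 + 16 * a) := by
          rw [le_div_iff₀ (by positivity)]; exact h
        have h'' : 1 / (1 + 16 * a) ≤ 1 - 8 * a := by
          rw [div_le_iff₀ (by positivity)]; nlinarith
        linarith
      have e3 : 1 / 8 ≤ Real.exp (-2) := by
        have : Real.exp 2 ≤ 8 := by
          have h1 : Real.exp 2 = Real.exp 1 * Real.exp 1 := by rw [← Real.exp_add]; norm_num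
          have h2 := Real.exp_one_lt_d9
          have h3 := Real.exp_pos 1
          rw [h1]; nlinarith
        rw [Real.exp_neg, ← one_div]
        exact one_div_le_one_div_of_le (Real.exp_pos _) this
      calc 1 - Real.exp (-a) ≤ 1 / 8 * (8 * a) := by linarith
        _ ≤ _ := by gcongr
    have hpow : (1 - Real.exp (-a)) ^ (r : ℝ) ≤
        Real.exp (-(2 * r)) * (1 - Real.exp (-(16 * a))) ^ (r : ℝ) := by
      calc (1 - Real.exp (-a)) ^ (r : ℝ) ≤ (Real.exp (-2) * (1 - Real.exp (-(16 * a)))) ^ (r : ℝ) :=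
            Real.rpow_le_rpow h0.le hratio (by positivity)
        _ = _ := by
            rw [Real.mul_rpow (Real.exp_pos _).le h16.le, ← Real.exp_mul]
            ring_nf
    have hc := multichoose_nonneg r.2 z
    simp only [negBinomialReal]
    calc Ring.multichoose (r : ℝ) z * Real.exp (-a) ^ z * (1 - Real.exp (-a)) ^ (r : ℝ)
        ≤ Ring.multichoose (r : ℝ) z * Real.exp (-a) ^ z *
          (Real.exp (-(2 * r)) * (1 - Real.exp (-(16 * a))) ^ (r : ℝ)) := by gcongr
      _ = Ring.multichoose (r : ℝ) z * (1 - Real.exp (-(16 * a))) ^ (r : ℝ) *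
          Real.exp (z * (-a) + -(2 * r)) := by
          rw [Real.exp_add, Real.exp_nat_mul]; ring
      _ ≤ Ring.multichoose (r : ℝ) z * (1 - Real.exp (-(16 * a))) ^ (r : ℝ) *
          Real.exp (-r + z * (-(16 * a))) := by
          gcongr Ring.multichoose (r : ℝ) z * (1 - Real.exp (-(16 * a))) ^ (r : ℝ) * Real.exp ?_
          -- Tilting costs `exp (15 * a * z) ≤ exp r`, which leaves `exp (-r)` of the gain `exp
          -- (-2r)`.
          nlinarith
      _ = _ := by
          rw [Real.exp_add, Real.exp_nat_mul]; ring
  · refine le_add_right ?_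
    push Not at hz
    cases z with
    | zero => simp at hz; linarith
    | succ z =>
      rw [pure_one_mul_apply_succ, negBinomial_apply, negBinomial_apply,
        ← ENNReal.ofReal_mul (Real.exp_pos _).le]
      refine ENNReal.ofReal_le_ofReal ?_
      have h := negBinomialReal_succ (a := a) r z
      have h2 := negBinomialReal_nonneg r.2 ha z
      have h3 : (z + 1 : ℝ) * negBinomialReal r a (z + 1) ≤
          (z + 1 : ℝ) * (Real.exp (15 * a) * negBinomialReal r a z) := by
        rw [h, ← mul_assoc]
        gcongr ?_ * _
        have e : Real.exp (15 * a) = Real.exp (-a) * Real.exp (16 * a) := by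
          rw [← Real.exp_add]; ring_nf
        rw [e, mul_left_comm]
        gcongr ?_ * ?_
        push_cast at hz
        have := Real.add_one_le_exp (16 * a)
        nlinarith
      exact le_of_mul_le_mul_left h3 (by positivity)

end PMF

/-! ### The Discrete Laplace law as a difference, and noise made of copies of one element. -/

namespace PMF

variable {a : ℝ} (ha : 0 < a)

theorem hasSum_negBinomialReal_one_mul {a : ℝ} (ha : 0 < a) (m : ℕ) :
    HasSum (fun j => negBinomialReal 1 a (j + m) * negBinomialReal 1 a j)
      ((1 - Real.exp (-a)) / (1 + Real.exp (-a)) * Real.exp (-a * m)) := by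
  have h0 := one_sub_exp_neg_pos ha
  have hq := Real.exp_pos (-a)
  have hm : Real.exp (-a * m) = Real.exp (-a) ^ m := by rw [← Real.exp_nat_mul]; ring_nf
  rw [hm]
  set q := Real.exp (-a) with hqdef
  have hg := (hasSum_geometric_of_lt_one (r := q ^ 2) (by positivity) (by nlinarith)).mul_left
    ((1 - q) ^ 2 * q ^ m)
  have hc : (1 - q) ^ 2 * q ^ m * (1 - q ^ 2)⁻¹ = (1 - q) / (1 + q) * q ^ m := by
    have h1 : 1 - q ≠ 0 := h0.ne'
    have h2 : 1 + q ≠ 0 := by positivity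
    rw [show 1 - q ^ 2 = (1 - q) * (1 + q) by ring]
    field_simp
  rw [hc] at hg
  refine hg.congr_fun fun j => ?_
  simp only [negBinomialReal, Ring.multichoose_one, Real.rpow_one, ← hqdef]
  ring

/-- The discrete Laplace distribution is the difference of two geometric distributions. -/
theorem map_negBinomial_one_mul_map_neg :
    (negBinomial 1 a ha).map (fun z : ℕ => (z : ℤ)) *
        (negBinomial 1 a ha).map (fun z : ℕ => -(z : ℤ)) =
      discreteLaplace a ha := by
  classical
  have hval : ∀ m : ℕ, (∑' j, negBinomial 1 a ha (j + m) * negBinomial 1 a ha j) =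
      ENNReal.ofReal ((1 - Real.exp (-a)) / (1 + Real.exp (-a)) * Real.exp (-a * m)) := by
    intro m
    have h := hasSum_negBinomialReal_one_mul ha m
    have hnn := fun z => negBinomialReal_nonneg (r := 1) zero_le_one ha z
    rw [← h.tsum_eq, ENNReal.ofReal_tsum_of_nonneg (fun j => mul_nonneg (hnn _) (hnn _))
      h.summable]
    exact tsum_congr fun j => by rw [ENNReal.ofReal_mul (hnn _)]; rfl
  have hind : ∀ (p : PMF ℤ) (k : ℤ), p k = p.expect fun z => if z = k then 1 else 0 := by
    intro p k
    rw [expect, tsum_eq_single k]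
    · simp
    · intro b hb
      simp [hb]
  ext k
  rw [hind, expect_mul, expect_map]
  simp only [expect_map]
  change _ = ENNReal.ofReal _
  obtain ⟨m, rfl | rfl⟩ := k.eq_nat_or_neg
  · have habs : |(((m : ℕ) : ℤ) : ℝ)| = m := by simp
    -- The outer sum has to run over the smaller of the two geometric variables: the subtracted one
    -- here, the first one when `k = -m`.
    rw [expect_comm, habs, ← hval m, expect]
    refine tsum_congr fun j => ?_
    rw [mul_comm]
    congr 1
    rw [expect, tsum_eq_single (j + m)]
    · simp
    · intro b hb
      rw [if_neg (by omega), mul_zero]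
  · have habs : |((-((m : ℕ) : ℤ) : ℤ) : ℝ)| = m := by simp
    rw [habs, ← hval m, expect]
    refine tsum_congr fun j => ?_
    rw [mul_comm]
    congr 1
    rw [expect, tsum_eq_single (j + m)]
    · simp
    · intro b hb
      rw [if_neg (by omega), mul_zero]

section NoiseTerm

variable {A : Type*} [AddCommMonoid A]

/-- The distribution of `z • S` for a negative binomial `z`. -/
def noiseTerm (S : A) (r : ℝ≥0) (a : ℝ) (ha : 0 < a) : PMF A :=
  mapHom (multiplesHom A S) (negBinomial r a ha)

theorem noiseTerm_div_pow (S : A) (r : ℝ≥0) {n : ℕ} (hn : 1 ≤ n) :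
    noiseTerm S (r / n) a ha ^ n = noiseTerm S r a ha := by
  rw [noiseTerm, ← map_pow, negBinomial_div_pow ha r hn, noiseTerm]

/-- One extra `S` is one extra copy, so comparisons of laws on `ℕ` carry over by pushforward. -/
theorem pure_mul_noiseTerm (S : A) (r : ℝ≥0) :
    pure S * noiseTerm S r a ha = mapHom (multiplesHom A S) (pure 1 * negBinomial r a ha) := by
  rw [map_mul, noiseTerm]
  congr 1
  rw [mapHom_apply, pure_map]
  simp

theorem pure_mul_noiseTerm_approxLE (S : A) {r : ℝ≥0} (hr : 1 ≤ r) :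
    ApproxLE a 0 (pure S * noiseTerm S r a ha) (noiseTerm S r a ha) := by
  rw [pure_mul_noiseTerm]
  exact (pure_one_mul_negBinomial_approxLE ha hr).map _

theorem noiseTerm_approxLE_pure_mul (S : A) {r : ℝ≥0} (hr : 1 ≤ r) (ha' : 16 * a ≤ 1) :
    ApproxLE (15 * a) (Real.exp (-r)) (noiseTerm S r a ha) (pure S * noiseTerm S r a ha) := by
  rw [pure_mul_noiseTerm]
  exact (negBinomial_approxLE_pure_one_mul ha hr ha').map _

theorem pure_nsmul_mul_noiseTerm_approxLE (S : A) {r : ℝ≥0} (hr : 1 ≤ r) (u : ℕ) :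
    ApproxLE (u * a) 0 (pure (u • S) * noiseTerm S r a ha) (noiseTerm S r a ha) := by
  have h := pure_sum_mul_approxLE (Finset.range u) (fun _ => S)
    fun _ _ => pure_mul_noiseTerm_approxLE ha S hr
  simpa using h

theorem map_noiseTerm {B : Type*} [AddCommMonoid B] (h : A →+ B) (S : A) (r : ℝ≥0) :
    (noiseTerm S r a ha).map h = (negBinomial r a ha).map fun z => z • h S := by
  rw [noiseTerm, mapHom_apply, map_comp]
  congr 1
  ext z
  simp

theorem map_noiseTerm_of_eq_zero {B : Type*} [AddCommMonoid B] (h : A →+ B) {S : A}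
    (hS : h S = 0) (r : ℝ≥0) : (noiseTerm S r a ha).map h = 1 := by
  rw [map_noiseTerm]
  simp only [hS, smul_zero]
  exact map_const _ _

theorem expect_card_noiseTerm_le {M : Type*} (S : Multiset M) (r : ℝ≥0) :
    (noiseTerm S r a ha).expect (fun s => (s.card : ℝ≥0∞)) ≤
      ENNReal.ofReal (S.card * (r / a)) := by
  rw [noiseTerm, mapHom_apply, expect_map]
  simp only [multiplesHom_apply, Multiset.card_nsmul, Nat.cast_mul, mul_comm _ (S.card : ℝ≥0∞)]
  rw [expect_const_mul, ENNReal.ofReal_mul (by positivity), ENNReal.ofReal_natCast]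
  gcongr
  exact expect_negBinomial_le ha r

end NoiseTerm

end PMF

/-! ### The total noise: divisibility, privacy cost, size and sum. -/

section FloodingNoise

variable {α M ι : Type*} [Fintype ι]

/-- The noise of the protocol: independent numbers of copies of the messages `up` and `down`, and
of each multiset `S j`. -/
def floodingNoise (up down : M) (S : ι → Multiset M) (c r : ℝ≥0) {s a : ℝ} (hs : 0 < s)
    (ha : 0 < a) : PMF (Multiset M) :=
  PMF.noiseTerm {up} c s hs * PMF.noiseTerm {down} c s hs * ∏ j, PMF.noiseTerm (S j) r a ha

variable (up down : M) (S : ι → Multiset M) {s a : ℝ} (hs : 0 < s) (ha : 0 < a)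

theorem floodingNoise_div_pow (c r : ℝ≥0) {n : ℕ} (hn : 1 ≤ n) :
    floodingNoise up down S (c / n) (r / n) hs ha ^ n = floodingNoise up down S c r hs ha := by
  simp only [floodingNoise, mul_pow, ← Finset.prod_pow, PMF.noiseTerm_div_pow _ _ _ hn]

theorem collect_pure_mul_floodingNoise (m : α → Multiset M) (c r : ℝ≥0) {n : ℕ} (hn : 1 ≤ n)
    (x : Fin n → α) :
    (collect n fun i => PMF.pure (m (x i)) * floodingNoise up down S (c / n) (r / n) hs ha) =
      PMF.pure (∑ i, m (x i)) * floodingNoise up down S c r hs ha := by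
  rw [collect_eq_prod, Finset.prod_mul_distrib, PMF.pure_sum, Finset.prod_const, Finset.card_univ,
    Fintype.card_fin, floodingNoise_div_pow _ _ _ _ _ _ _ hn]

/-- The noise first supplies the multisets of `B`, the only moves that cost `δ`. By `h` the messages
can then be regrouped around `Y`, and the noise absorbs the multisets of `A` and the copies of `up`
and `down`. These copies stand on the side of `Y` only, since geometric noise can absorb messages at
no cost in `δ`. -/
theorem approxLE_floodingNoise {r : ℝ≥0} (hr : 1 ≤ r) (ha' : 16 * a ≤ 1) {X Y : Multiset M}
    (A B : Finset ι) (u d : ℕ)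
    (h : X + ∑ j ∈ B, S j = Y + ∑ j ∈ A, S j + u • {up} + d • {down}) :
    PMF.ApproxLE (B.card * (15 * a) + (A.card * a + (u + d) * s))
      (Real.exp (B.card * (15 * a)) * (B.card * Real.exp (-r)))
      (PMF.pure X * floodingNoise up down S 1 r hs ha)
      (PMF.pure Y * floodingNoise up down S 1 r hs ha) := by
  classical
  set N := floodingNoise up down S 1 r hs ha with hN
  have hsplit : ∀ j, ∃ R, N = R * PMF.noiseTerm (S j) r a ha := fun j =>
    ⟨_, by rw [hN, floodingNoise, ← Finset.prod_erase_mul _ _ (Finset.mem_univ j), ← mul_assoc]⟩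
  have hB : PMF.ApproxLE (B.card * (15 * a))
      (Real.exp (B.card * (15 * a)) * (B.card * Real.exp (-r))) N
      (PMF.pure (∑ j ∈ B, S j) * N) := by
    refine PMF.approxLE_pure_sum_mul (by positivity) (by positivity) B S fun j _ => ?_
    obtain ⟨R, hR⟩ := hsplit j
    rw [hR, mul_left_comm]
    exact (PMF.noiseTerm_approxLE_pure_mul ha _ hr ha').mul_left _
  have hA : PMF.ApproxLE (A.card * a) 0 (PMF.pure (∑ j ∈ A, S j) * N) N := by
    refine PMF.pure_sum_mul_approxLE A S fun j _ => ?_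
    obtain ⟨R, hR⟩ := hsplit j
    rw [hR, mul_left_comm]
    exact (PMF.pure_mul_noiseTerm_approxLE ha _ hr).mul_left _
  have hu : PMF.ApproxLE (u * s) 0 (PMF.pure (u • {up}) * N) N := by
    have := (PMF.pure_nsmul_mul_noiseTerm_approxLE hs ({up} : Multiset M) le_rfl u).mul_left
      (PMF.noiseTerm {down} 1 s hs * ∏ j, PMF.noiseTerm (S j) r a ha)
    convert this using 1
    · rw [hN, floodingNoise]; ac_rfl
    · rw [hN, floodingNoise]; ac_rfl
  have hd : PMF.ApproxLE (d * s) 0 (PMF.pure (d • {down}) * N) N := by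
    have := (PMF.pure_nsmul_mul_noiseTerm_approxLE hs ({down} : Multiset M) le_rfl d).mul_left
      (PMF.noiseTerm {up} 1 s hs * ∏ j, PMF.noiseTerm (S j) r a ha)
    convert this using 1
    · rw [hN, floodingNoise]; ac_rfl
    · rw [hN, floodingNoise]; ac_rfl
  have h1 := hB.mul_left (PMF.pure X)
  have h2 : PMF.ApproxLE (A.card * a) 0 (PMF.pure (X + ∑ j ∈ B, S j) * N)
      (PMF.pure (Y + u • {up} + d • {down}) * N) := by
    have := hA.mul_left (PMF.pure (Y + u • {up} + d • {down}))
    rwa [← mul_assoc, ← PMF.pure_add, show Y + u • {up} + d • {down} + ∑ j ∈ A, S j =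
      X + ∑ j ∈ B, S j by rw [h]; abel] at this
  have h3 := hd.mul_left (PMF.pure (Y + u • {up}))
  have h4 := hu.mul_left (PMF.pure Y)
  rw [← mul_assoc (PMF.pure X), ← PMF.pure_add] at h1
  rw [← mul_assoc (PMF.pure _), ← PMF.pure_add] at h3 h4
  refine (h1.trans (h2.trans (h3.trans h4 le_rfl le_rfl) le_rfl (by simp)) (by positivity)
    (by simp)).mono (by linarith) (by simp)

theorem expect_card_floodingNoise_le (c r : ℝ≥0) :
    (floodingNoise up down S c r hs ha).expect (fun z : Multiset M => (z.card : ℝ≥0∞)) ≤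
      ENNReal.ofReal (2 * (c / s) + (∑ j, ((S j).card : ℝ)) * (r / a)) := by
  have hadd : ∀ x y : Multiset M, ((x + y).card : ℝ≥0∞) = x.card + y.card := by simp
  rw [floodingNoise, PMF.expect_mul_addHom _ _ _ hadd, PMF.expect_mul_addHom _ _ _ hadd,
    PMF.expect_prod_addHom _ _ _ (by simp) hadd, ENNReal.ofReal_add (by positivity) (by positivity),
    two_mul, ENNReal.ofReal_add (by positivity) (by positivity), Finset.sum_mul,
    ENNReal.ofReal_sum_of_nonneg fun j _ => by positivity]
  have h1 : ∀ v : M, (PMF.noiseTerm {v} c s hs).expect (fun z : Multiset M => (z.card : ℝ≥0∞)) ≤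
      ENNReal.ofReal (c / s) := fun v => by
    simpa using PMF.expect_card_noiseTerm_le hs ({v} : Multiset M) c
  gcongr
  · exact h1 up
  · exact h1 down
  · exact PMF.expect_card_noiseTerm_le ha _ r

theorem map_floodingNoise_eq_discreteLaplace (h : Multiset M →+ ℤ) (hup : h {up} = 1)
    (hdown : h {down} = -1) (hS : ∀ j, h (S j) = 0) (r : ℝ≥0) :
    (floodingNoise up down S 1 r hs ha).map h = discreteLaplace s hs := by
  rw [← PMF.mapHom_apply, floodingNoise, map_mul, map_mul, map_prod, Finset.prod_eq_one, mul_one]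
  · rw [PMF.mapHom_apply, PMF.mapHom_apply, PMF.map_noiseTerm, PMF.map_noiseTerm, hup, hdown,
      ← PMF.map_negBinomial_one_mul_map_neg]
    simp
  · intro j _
    exact PMF.map_noiseTerm_of_eq_zero ha h (hS j) r

end FloodingNoise

/-- Lets the shuffler be dropped for an analyzer that ignores the order of the messages. -/
theorem shuffle_expect_eq {M : Type*} (s : Multiset M) (f : List M → ℝ≥0∞) (c : ℝ≥0∞)
    (h : ∀ l : List M, (l : Multiset M) = s → f l = c) : (shuffle s).expect f = c := by
  rw [← PMF.expect_const (shuffle s) c]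
  refine tsum_congr fun l => ?_
  by_cases hl : l ∈ (shuffle s).support
  · rw [h l]
    rw [shuffle, PMF.support_ofMultiset] at hl
    have hl' : l ∈ s.toList.permutations := by simpa using hl
    rw [List.mem_permutations] at hl'
    rw [Multiset.coe_eq_coe.mpr hl', Multiset.coe_toList]
  · rw [PMF.mem_support_iff, not_not] at hl
    rw [hl, zero_mul, zero_mul]

/-! ### Messages as signed integers. -/

section Encoding

/-- The positive integer `v ≤ Δ` as a message. -/
def encodePos (Δ v : ℕ) : BitVec (Nat.clog 2 Δ + 1) := BitVec.ofNat _ (v - 1)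

/-- The negative integer `-v`, where `1 ≤ v ≤ Δ`, as a message. -/
def encodeNeg (Δ v : ℕ) : BitVec (Nat.clog 2 Δ + 1) := BitVec.ofNat _ (Δ + (v - 1))

/-- The nonzero integer in `{-Δ, ..., Δ}` that a message stands for. -/
def decode (Δ : ℕ) (b : BitVec (Nat.clog 2 Δ + 1)) : ℤ :=
  if b.toNat < Δ then b.toNat + 1 else Δ - b.toNat - 1

/-- There is room for all `2 * Δ` nonzero integers, so neither encoding wraps around. -/
theorem two_mul_le_two_pow_clog (Δ : ℕ) : 2 * Δ ≤ 2 ^ (Nat.clog 2 Δ + 1) := by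
  have := Nat.le_pow_clog (b := 2) (by norm_num) Δ
  rw [pow_succ]
  omega

theorem decode_encodePos {Δ v : ℕ} (h1 : 1 ≤ v) (h2 : v ≤ Δ) : decode Δ (encodePos Δ v) = v := by
  have h := two_mul_le_two_pow_clog Δ
  rw [decode, encodePos, BitVec.toNat_ofNat, Nat.mod_eq_of_lt (by omega), if_pos (by omega)]
  omega

theorem decode_encodeNeg {Δ v : ℕ} (h1 : 1 ≤ v) (h2 : v ≤ Δ) : decode Δ (encodeNeg Δ v) = -v := by
  have h := two_mul_le_two_pow_clog Δ
  rw [decode, encodeNeg, BitVec.toNat_ofNat, Nat.mod_eq_of_lt (by omega), if_neg (by omega)]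
  omega

/-- The sum of the integers that the messages stand for. -/
def decodeSum (Δ : ℕ) : Multiset (BitVec (Nat.clog 2 Δ + 1)) →+ ℤ :=
  Multiset.sumAddMonoidHom.comp (Multiset.mapAddMonoidHom (decode Δ))

@[simp]
theorem decodeSum_singleton (Δ : ℕ) (b : BitVec (Nat.clog 2 Δ + 1)) :
    decodeSum Δ {b} = decode Δ b := by
  simp [decodeSum]

theorem decodeSum_coe (Δ : ℕ) (l : List (BitVec (Nat.clog 2 Δ + 1))) :
    decodeSum Δ l = (l.map (decode Δ)).sum := by
  simp [decodeSum]

end Encoding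

/-! ### The flooding multisets and the exchange of two inputs. -/

section FloodingMultisets

/-- The positions less than `t` of the binary digits `1` of `y`. -/
def binaryDigits (t y : ℕ) : Finset (Fin t) :=
  Finset.univ.filter fun b => (b : ℕ) ∈ y.bitIndices

theorem sum_two_pow_binaryDigits {t y : ℕ} (h : y < 2 ^ t) :
    ∑ b ∈ binaryDigits t y, 2 ^ (b : ℕ) = y := by
  conv_rhs => rw [← Finset.sum_toFinset_bitIndices_two_pow y]
  refine Finset.sum_bij (fun b _ => (b : ℕ)) ?_ ?_ ?_ ?_
  · intro b hb
    simpa [binaryDigits] using hb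
  · intro b _ b' _ hbb
    exact Fin.ext hbb
  · intro i hi
    have hi' : i ∈ y.bitIndices := by simpa using hi
    have hlt : i < t := by
      have := Nat.two_pow_le_of_mem_bitIndices hi'
      exact (Nat.pow_lt_pow_iff_right (by norm_num)).mp (this.trans_lt h)
    exact ⟨⟨i, hlt⟩, by simpa [binaryDigits] using hi', rfl⟩
  · intro _ _
    rfl

/-- The message that carries the input `x`; there is none if `x = 0`. -/
def inputMessage (Δ x : ℕ) : Multiset (BitVec (Nat.clog 2 Δ + 1)) :=
  if x = 0 then 0 else {encodePos Δ x}

/-- The indices of the flooding multisets. -/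
abbrev FloodingIndex (Δ : ℕ) : Type := Fin (Δ + 1) ⊕ (Fin Δ.size ⊕ Fin Δ.size)

/-- The negatives of the powers of two that add up to `x`. -/
def negDigits (Δ x : ℕ) : Multiset (BitVec (Nat.clog 2 Δ + 1)) :=
  ∑ b ∈ binaryDigits Δ.size x, {encodeNeg Δ (2 ^ (b : ℕ))}

/-- The flooding multisets, each of which stands for integers with sum zero: an input with the
negatives of its binary digits; the negative of a power of two `2 ^ b` with `2 ^ b` ones; and
`2 ^ b` copies of `1` and `-1`. -/
def floodingMultiset (Δ : ℕ) : FloodingIndex Δ → Multiset (BitVec (Nat.clog 2 Δ + 1))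
  | .inl x => inputMessage Δ x + negDigits Δ x
  | .inr (.inl b) => {encodeNeg Δ (2 ^ (b : ℕ))} + 2 ^ (b : ℕ) • {encodePos Δ 1}
  | .inr (.inr b) => 2 ^ (b : ℕ) • ({encodePos Δ 1} + {encodeNeg Δ 1})

variable {Δ : ℕ}

theorem decodeSum_inputMessage {x : ℕ} (hx : x ≤ Δ) : decodeSum Δ (inputMessage Δ x) = x := by
  by_cases h : x = 0
  · simp [inputMessage, h]
  · rw [inputMessage, if_neg h, decodeSum_singleton, decode_encodePos (by omega) hx]

theorem decodeSum_encodeNeg_two_pow (b : Fin Δ.size) :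
    decodeSum Δ {encodeNeg Δ (2 ^ (b : ℕ))} = -2 ^ (b : ℕ) := by
  rw [decodeSum_singleton, decode_encodeNeg Nat.one_le_two_pow (Nat.lt_size.mp b.2)]
  simp

theorem decodeSum_negDigits {x : ℕ} (hx : x ≤ Δ) : decodeSum Δ (negDigits Δ x) = -x := by
  rw [negDigits, map_sum, Finset.sum_congr rfl fun b _ => decodeSum_encodeNeg_two_pow b,
    Finset.sum_neg_distrib]
  have := sum_two_pow_binaryDigits (hx.trans_lt Δ.lt_size_self)
  conv_rhs => rw [← this]
  push_cast
  rfl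

theorem decodeSum_floodingMultiset (hΔ : 1 ≤ Δ) (j : FloodingIndex Δ) :
    decodeSum Δ (floodingMultiset Δ j) = 0 := by
  match j with
  | .inl x =>
    have hx : (x : ℕ) ≤ Δ := Nat.lt_succ_iff.mp x.2
    rw [floodingMultiset, map_add, decodeSum_inputMessage hx, decodeSum_negDigits hx]
    ring
  | .inr (.inl b) =>
    rw [floodingMultiset, map_add, decodeSum_encodeNeg_two_pow, map_nsmul, decodeSum_singleton,
      decode_encodePos le_rfl hΔ]
    simp
  | .inr (.inr b) =>
    rw [floodingMultiset, map_nsmul, map_add, decodeSum_singleton, decodeSum_singleton,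
      decode_encodePos le_rfl hΔ, decode_encodeNeg le_rfl hΔ]
    simp

theorem card_inputMessage_le (x : ℕ) : (inputMessage Δ x).card ≤ 1 := by
  rw [inputMessage]
  split_ifs <;> simp

theorem card_binaryDigits_le (t x : ℕ) : (binaryDigits t x).card ≤ t :=
  (Finset.card_le_univ _).trans (by simp)

/-- Each of the `Δ + 1` inputs contributes at most one message per binary digit and one more; the
powers of two form a geometric sum of order `Δ`. -/
theorem sum_card_floodingMultiset_le (hΔ : 1 ≤ Δ) :
    ∑ j, (floodingMultiset Δ j).card ≤ 9 * Δ * (1 + Δ.size) := by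
  have h1 : ∑ x : Fin (Δ + 1), (floodingMultiset Δ (.inl x)).card ≤ (Δ + 1) * (1 + Δ.size) := by
    refine (Finset.sum_le_card_nsmul _ _ (1 + Δ.size) fun x _ => ?_).trans (by simp)
    rw [floodingMultiset, Multiset.card_add, negDigits, Multiset.card_sum]
    simpa using add_le_add (card_inputMessage_le _) (card_binaryDigits_le _ _)
  have hgeom : ∑ b : Fin Δ.size, 2 ^ (b : ℕ) ≤ 2 * Δ := by
    rw [Fin.sum_univ_eq_sum_range (fun b => 2 ^ b), Nat.geomSum_eq le_rfl]
    have : 2 ^ (Δ.size - 1) ≤ Δ :=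
      Nat.lt_size.mp (Nat.sub_lt (Nat.size_pos.mpr hΔ) one_pos)
    have h2 : 2 ^ Δ.size = 2 * 2 ^ (Δ.size - 1) := by
      rw [← pow_succ', Nat.sub_add_cancel (Nat.size_pos.mpr hΔ)]
    simp
    omega
  have h2 : ∑ b : Fin Δ.size, (floodingMultiset Δ (.inr (.inl b))).card ≤ Δ.size + 2 * Δ := by
    simp only [floodingMultiset, Multiset.card_add, Multiset.card_singleton, Multiset.card_nsmul,
      mul_one, Finset.sum_add_distrib]
    simpa using hgeom
  have h3 : ∑ b : Fin Δ.size, (floodingMultiset Δ (.inr (.inr b))).card ≤ 4 * Δ := by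
    simp only [floodingMultiset, Multiset.card_add, Multiset.card_singleton, Multiset.card_nsmul,
      ← Finset.sum_mul]
    omega
  rw [Fintype.sum_sum_type, Fintype.sum_sum_type]
  nlinarith [Nat.zero_le Δ.size]

/-- The flooding multisets that are added to and removed from the messages when an input changes
from `x` to `y`. -/
theorem inputMessage_exchange (x y : Fin (Δ + 1)) :
    inputMessage Δ x + ∑ j ∈ ({y} : Finset (Fin (Δ + 1))).disjSum
        ((binaryDigits Δ.size x).disjSum (binaryDigits Δ.size ((y : ℕ) - x))),
          floodingMultiset Δ j =
      inputMessage Δ y + ∑ j ∈ ({x} : Finset (Fin (Δ + 1))).disjSum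
        ((binaryDigits Δ.size y).disjSum ∅), floodingMultiset Δ j +
        ((x : ℕ) - y) • {encodePos Δ 1} + ((y : ℕ) - x) • {encodeNeg Δ 1} := by
  have hlt : ∀ z, z ≤ Δ → z < 2 ^ Δ.size := fun z hz => hz.trans_lt Δ.lt_size_self
  have hx := Nat.lt_succ_iff.mp x.2
  have hy := Nat.lt_succ_iff.mp y.2
  have hdigits : ∀ z, z ≤ Δ → ∑ b ∈ binaryDigits Δ.size z, floodingMultiset Δ (.inr (.inl b)) =
      negDigits Δ z + z • {encodePos Δ 1} := by
    intro z hz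
    rw [negDigits]
    conv_rhs => rw [← sum_two_pow_binaryDigits (hlt z hz)]
    rw [Finset.sum_smul, sum_two_pow_binaryDigits (hlt z hz), ← Finset.sum_add_distrib]
    rfl
  have hpairs : ∀ z, z ≤ Δ → ∑ b ∈ binaryDigits Δ.size z, floodingMultiset Δ (.inr (.inr b)) =
      z • {encodePos Δ 1} + z • {encodeNeg Δ 1} := by
    intro z hz
    rw [← smul_add]
    conv_rhs => rw [← sum_two_pow_binaryDigits (hlt z hz)]
    rw [Finset.sum_smul]
    rfl
  have hinput : ∀ z : Fin (Δ + 1), floodingMultiset Δ (.inl z) =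
      inputMessage Δ z + negDigits Δ z := fun _ => rfl
  simp only [Finset.sum_disjSum, Finset.sum_singleton, Finset.sum_empty, hinput]
  rw [hdigits _ hx, hdigits _ hy, hpairs _ (by omega)]
  -- With truncated subtraction both coefficients are the maximum of `x` and `y`. If `y > x`, the
  -- missing ones on the left come from `y - x` pairs of `1` and `-1`, whose negative halves become
  -- central messages on the right.
  have h : ((x : ℕ) + (y - x)) • ({encodePos Δ 1} : Multiset (BitVec (Nat.clog 2 Δ + 1))) =
      ((y : ℕ) + (x - y)) • {encodePos Δ 1} := by
    congr 1
    omega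
  rw [add_smul, add_smul] at h
  generalize ({encodePos Δ 1} : Multiset (BitVec (Nat.clog 2 Δ + 1))) = e at *
  calc _ = inputMessage Δ x + inputMessage Δ y + negDigits Δ x + negDigits Δ y +
        ((y : ℕ) - x) • {encodeNeg Δ 1} + ((x : ℕ) • e + ((y : ℕ) - x) • e) := by ac_rfl
    _ = inputMessage Δ x + inputMessage Δ y + negDigits Δ x + negDigits Δ y +
        ((y : ℕ) - x) • {encodeNeg Δ 1} + ((y : ℕ) • e + ((x : ℕ) - y) • e) := by rw [h]
    _ = _ := by rw [add_zero]; ac_rfl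

end FloodingMultisets

/-! ### The summation protocol: privacy, error and communication. -/

section Protocol

variable {Δ : ℕ} (r : ℝ≥0) {s a : ℝ} (hs : 0 < s) (ha : 0 < a)

/-- The noise of the summation protocol. -/
abbrev summationNoise (Δ : ℕ) (c r : ℝ≥0) {s a : ℝ} (hs : 0 < s) (ha : 0 < a) :
    PMF (Multiset (BitVec (Nat.clog 2 Δ + 1))) :=
  floodingNoise (encodePos Δ 1) (encodeNeg Δ 1) (floodingMultiset Δ) c r hs ha

/-- The protocol for summation: every user sends its input together with its share of the noise,
and the analyzer adds up all messages. -/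
def summationProtocol (Δ n : ℕ) (r : ℝ≥0) {s a : ℝ} (hs : 0 < s) (ha : 0 < a) :
    ShuffleProtocol (Fin (Δ + 1)) (BitVec (Nat.clog 2 Δ + 1)) where
  randomizer x := PMF.pure (inputMessage Δ x) * summationNoise Δ (1 / n) (r / n) hs ha
  analyzer l := ((l.map (decode Δ)).sum : ℤ)

variable {n : ℕ} (hn : 1 ≤ n)

include hn in
theorem summationProtocol_view (x : Fin n → Fin (Δ + 1)) :
    (summationProtocol Δ n r hs ha).view x =
      (PMF.pure (∑ i, inputMessage Δ (x i)) * summationNoise Δ 1 r hs ha).bind shuffle := by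
  rw [ShuffleProtocol.view]
  congr 1
  exact collect_pure_mul_floodingNoise _ _ _ hs ha (fun x : Fin (Δ + 1) => inputMessage Δ x) 1 r hn x

theorem approxLE_inputMessage {r : ℝ≥0} (hr : 1 ≤ r) (ha' : 16 * a ≤ 1) {ε δ : ℝ}
    (hε : (31 * (Δ.size + 1)) * a + Δ * s ≤ ε)
    (hδ : Real.exp (31 * (Δ.size + 1) * a) * ((1 + 2 * Δ.size) * Real.exp (-r)) ≤ δ)
    (x y : Fin (Δ + 1)) (R : Multiset (BitVec (Nat.clog 2 Δ + 1))) :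
    PMF.ApproxLE ε δ (PMF.pure (inputMessage Δ x + R) * summationNoise Δ 1 r hs ha)
      (PMF.pure (inputMessage Δ y + R) * summationNoise Δ 1 r hs ha) := by
  have h := approxLE_floodingNoise (encodePos Δ 1) (encodeNeg Δ 1) (floodingMultiset Δ) hs ha hr ha'
    _ _ _ _ (inputMessage_exchange x y)
  have hB : (((({y} : Finset (Fin (Δ + 1))).disjSum ((binaryDigits Δ.size x).disjSum
      (binaryDigits Δ.size ((y : ℕ) - x)))).card : ℕ) : ℝ) ≤ 1 + 2 * Δ.size := by
    have h1 := card_binaryDigits_le Δ.size x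
    have h2 := card_binaryDigits_le Δ.size ((y : ℕ) - x)
    rw [Finset.card_disjSum, Finset.card_disjSum, Finset.card_singleton]
    exact_mod_cast (by omega)
  have hA : (((({x} : Finset (Fin (Δ + 1))).disjSum ((binaryDigits Δ.size y).disjSum
      (∅ : Finset (Fin Δ.size)))).card : ℕ) : ℝ) ≤ 1 + Δ.size := by
    have h1 := card_binaryDigits_le Δ.size y
    rw [Finset.card_disjSum, Finset.card_disjSum, Finset.card_singleton, Finset.card_empty]
    exact_mod_cast (by omega)
  have hu : ((((x : ℕ) - y : ℕ) : ℝ) + ((y : ℕ) - x : ℕ)) ≤ Δ := by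
    have h1 := x.2
    have h2 := y.2
    exact_mod_cast (by omega)
  have h' := (h.mono (ε' := ε) (δ' := δ) ?_ ?_).mul_left (PMF.pure R)
  · rwa [← mul_assoc, ← mul_assoc, ← PMF.pure_add, ← PMF.pure_add, add_comm R, add_comm R] at h'
  · refine le_trans ?_ hε
    -- The flooding part is `(16 + 31 * Δ.size) * a`, whence the constant `31`.
    calc _ ≤ (1 + 2 * Δ.size) * (15 * a) + ((1 + Δ.size) * a + Δ * s) := by gcongr
      _ ≤ _ := by nlinarith [mul_nonneg (Nat.cast_nonneg Δ.size : (0 : ℝ) ≤ Δ.size) ha.le]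
  · refine le_trans ?_ hδ
    gcongr Real.exp ?_ * (?_ * Real.exp (-r))
    calc _ ≤ (1 + 2 * (Δ.size : ℝ)) * (15 * a) := by gcongr
      _ ≤ _ := by nlinarith [mul_nonneg (Nat.cast_nonneg Δ.size : (0 : ℝ) ≤ Δ.size) ha.le]

include hn in
theorem isDP_summationProtocol {r : ℝ≥0} (hr : 1 ≤ r) (ha' : 16 * a ≤ 1) {ε δ : ℝ}
    (hε : (31 * (Δ.size + 1)) * a + Δ * s ≤ ε)
    (hδ : Real.exp (31 * (Δ.size + 1) * a) * ((1 + 2 * Δ.size) * Real.exp (-r)) ≤ δ) :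
    IsDP (fun x : Fin n → Fin (Δ + 1) => (summationProtocol Δ n r hs ha).view x) ε δ := by
  classical
  intro x x' hxx
  have : Nonempty (Fin n) := ⟨⟨0, hn⟩⟩
  refine PMF.ApproxLE.toOuterMeasure_le ?_
  simp only [summationProtocol_view r hs ha hn]
  refine PMF.ApproxLE.bind ?_ _
  obtain ⟨i, hi⟩ : ∃ i, ∀ j, j ≠ i → x j = x' j := by
    obtain ⟨i, hi⟩ := (Finset.card_le_one_iff_subset_singleton
      (s := Finset.univ.filter fun i => x i ≠ x' i) ).mp hxx
    refine ⟨i, fun j hj => ?_⟩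
    by_contra hne
    exact hj (by simpa using hi (by simpa using hne))
  rw [← Finset.add_sum_erase _ _ (Finset.mem_univ i),
    ← Finset.add_sum_erase _ (fun i => inputMessage Δ (x' i)) (Finset.mem_univ i),
    Finset.sum_congr rfl fun j hj => by rw [hi j (Finset.ne_of_mem_erase hj)]]
  exact approxLE_inputMessage hs ha hr ha' hε hδ _ _ _

include hn in
theorem meanSquaredError_summationProtocol (hΔ : 1 ≤ Δ) (x : Fin n → Fin (Δ + 1)) :
    meanSquaredError ((summationProtocol Δ n r hs ha).output x) (trueSum x : ℝ) =
      meanSquaredError (discreteLaplaceMechanism s hs x) (trueSum x : ℝ) := by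
  have hsum : decodeSum Δ (∑ i, inputMessage Δ (x i)) = trueSum x := by
    rw [map_sum, trueSum]
    exact Finset.sum_congr rfl fun i _ => decodeSum_inputMessage (Nat.lt_succ_iff.mp (x i).2)
  have hlaw : (PMF.pure (∑ i, inputMessage Δ (x i)) * summationNoise Δ 1 r hs ha).map
      (decodeSum Δ) = PMF.pure (trueSum x) * discreteLaplace s hs := by
    rw [← PMF.mapHom_apply, map_mul, PMF.mapHom_apply, PMF.mapHom_apply, PMF.pure_map, hsum,
      map_floodingNoise_eq_discreteLaplace _ _ _ hs ha (decodeSum Δ)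
        (by rw [decodeSum_singleton, decode_encodePos le_rfl hΔ]; rfl)
        (by rw [decodeSum_singleton, decode_encodeNeg le_rfl hΔ]; rfl)
        (decodeSum_floodingMultiset hΔ)]
  change PMF.expect _ _ = PMF.expect _ _
  rw [ShuffleProtocol.output, summationProtocol_view r hs ha hn, discreteLaplaceMechanism,
    PMF.expect_map, PMF.expect_map, PMF.expect_bind]
  have hshuffle : ∀ z, (shuffle z).expect (fun l => ENNReal.ofReal
      (((summationProtocol Δ n r hs ha).analyzer l - (trueSum x : ℝ)) ^ 2)) =
      ENNReal.ofReal (((decodeSum Δ z : ℤ) - (trueSum x : ℝ)) ^ 2) := by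
    intro z
    refine shuffle_expect_eq z _ _ fun l hl => ?_
    rw [← hl, decodeSum_coe]
    rfl
  simp only [hshuffle]
  rw [← PMF.expect_map _ (decodeSum Δ) fun z : ℤ => ENNReal.ofReal ((z - (trueSum x : ℝ)) ^ 2),
    hlaw]
  simp

theorem expectedMessages_summationProtocol_le (hΔ : 1 ≤ Δ) (x : Fin (Δ + 1)) :
    (summationProtocol Δ n r hs ha).expectedMessages x ≤
      ENNReal.ofReal (1 + (2 / (n * s) + 9 * Δ * (1 + Δ.size) * r / (n * a))) := by
  change PMF.expect (PMF.pure _ * _) _ ≤ _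
  rw [PMF.expect_mul_addHom _ _ _ (by simp), PMF.expect_pure,
    ENNReal.ofReal_add zero_le_one (by positivity), ENNReal.ofReal_one]
  gcongr
  · exact_mod_cast card_inputMessage_le _
  · refine (expect_card_floodingNoise_le _ _ _ hs ha _ _).trans (ENNReal.ofReal_le_ofReal ?_)
    have h : (∑ j, ((floodingMultiset Δ j).card : ℝ)) ≤ 9 * Δ * (1 + Δ.size) := by
      exact_mod_cast sum_card_floodingMultiset_le hΔ
    push_cast
    calc _ ≤ 2 * (1 / n / s) + 9 * Δ * (1 + Δ.size) * (r / n / a) := by gcongr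
      _ = _ := by rw [div_div, div_div, mul_one_div, mul_div_assoc (_ * _)]

end Protocol

/-! ### Choice of the parameters. -/

theorem size_add_one_le {Δ : ℕ} (hΔ : 1 ≤ Δ) : (Δ.size + 1 : ℝ) ≤ 2 * (1 + Real.log Δ) := by
  have hpos := Nat.size_pos.mpr hΔ
  have h1 : 2 ^ (Δ.size - 1) ≤ Δ := Nat.lt_size.mp (Nat.sub_lt hpos one_pos)
  have h2 : (2 : ℝ) ^ (Δ.size - 1) ≤ Δ := by exact_mod_cast h1
  have h3 := Real.log_le_log (by positivity) h2
  rw [Real.log_pow, Nat.cast_sub hpos] at h3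
  have h4 := Real.log_two_gt_d9
  have h5 : (1 : ℝ) ≤ Δ.size := by exact_mod_cast hpos
  push_cast at h3
  nlinarith

end

theorem theorem2 :
    ∃ k : ℕ, ∀ ε₀ : ℝ, 0 < ε₀ → ∃ C : ℝ, 0 < C ∧
      ∀ (ε γ δ : ℝ) (Δ n : ℕ) (hε : 0 < ε) (_ : ε ≤ ε₀) (_ : 0 < γ) (hγ : γ < 1 / 2)
        (_ : 0 < δ) (_ : δ < 1 / 2) (hΔ : 1 ≤ Δ) (_ : 1 ≤ n),
        -- inputs are in `{0, ..., Δ}`, messages are strings of `⌈log₂ Δ⌉ + 1` bits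
        ∃ P : ShuffleProtocol (Fin (Δ + 1)) (BitVec (Nat.clog 2 Δ + 1)),
          IsDP (fun x : Fin n → Fin (Δ + 1) => P.view x) ε δ ∧
          (∀ x : Fin n → Fin (Δ + 1),
            meanSquaredError (P.output x) (trueSum x : ℝ) ≤
              meanSquaredError
                (discreteLaplaceMechanism ((1 - γ) * ε / (Δ : ℝ)) (param_pos hε hγ hΔ) x)
                (trueSum x : ℝ)) ∧
          ∀ a : Fin (Δ + 1),
            P.expectedMessages a ≤
              ENNReal.ofReal
                (1 + C * (1 + Real.log Δ) ^ k *
                  ((Δ : ℝ) * Real.log (1 / δ) / (γ * ε * n))) := by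
  -- The three logarithmic factors come from the total size of the flooding multisets, from `1 / a`
  -- and from `r`. The `4` pays for the central noise; `1152 = 9 * 32 * 2 ^ 2` collects the
  -- constants of the size bound, of `a` and of `t + 1 ≤ 2 * Λ`.
  refine ⟨3, fun ε₀ hε₀ => ⟨4 + 1152 * (1 + ε₀) * (2 * ε₀ + 9), by positivity, ?_⟩⟩
  intro ε γ δ Δ n hε hεε₀ hγ0 hγ hδ0 hδ hΔ hn
  have hn' : (0 : ℝ) < n := by exact_mod_cast hn
  have hΔ' : (1 : ℝ) ≤ Δ := by exact_mod_cast hΔ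
  set t : ℝ := ((Δ.size : ℕ) : ℝ) with ht
  have ht0 : 0 ≤ t := Nat.cast_nonneg _
  set Λ := 1 + Real.log Δ with hΛ
  have hΛ1 : 1 ≤ Λ := by linarith [Real.log_nonneg hΔ']
  have htΛ : t + 1 ≤ 2 * Λ := size_add_one_le hΔ
  set L := Real.log (1 / δ) with hL
  have hL2 : 1 / 2 ≤ L := by
    have h1 : Real.log 2 ≤ L := Real.log_le_log (by norm_num) (by
      rw [le_div_iff₀ hδ0]; linarith)
    linarith [Real.log_two_gt_d9]
  have hγε : γ * ε ≤ ε₀ := by nlinarith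
  -- The flooding may spend `γ * ε`, what the central noise leaves of `ε`. The factor `1 + ε₀`
  -- forces `16 * a ≤ 1` even for large `ε₀`.
  set a := γ * ε / (32 * (t + 1) * (1 + ε₀)) with hadef
  have ha : 0 < a := by positivity
  have hmul : 32 * (t + 1) * (1 + ε₀) * a = γ * ε := by rw [hadef]; field_simp
  have hta : 0 ≤ t * a := by positivity
  have h32 : 32 * (t + 1) * a ≤ γ * ε := by
    rw [← hmul]
    nlinarith [mul_nonneg hε₀.le ha.le, mul_nonneg hε₀.le hta]
  have ha' : 16 * a ≤ 1 := by
    have h1 : (1 + ε₀) * (16 * a) ≤ (1 + ε₀) * 1 := by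
      nlinarith [mul_nonneg hε₀.le ha.le, mul_nonneg hε₀.le hta]
    exact le_of_mul_le_mul_left h1 (by positivity)
  -- In `exp (-r)`, the summand `ε₀` offsets the inflation of `δ` under composition, `1 + 2 * t` the
  -- number of supplied multisets, and `L` leaves `δ`.
  set r : ℝ≥0 := ⟨ε₀ + (1 + 2 * t) + L, by positivity⟩ with hrdef
  have hrval : (r : ℝ) = ε₀ + (1 + 2 * t) + L := rfl
  have hr : 1 ≤ r := by
    rw [← NNReal.coe_le_coe, hrval, NNReal.coe_one]
    linarith
  have hs := param_pos hε hγ hΔ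
  refine ⟨summationProtocol Δ n r hs ha, isDP_summationProtocol hs ha hn hr ha' ?_ ?_,
    fun x => (meanSquaredError_summationProtocol r hs ha hn hΔ x).le, fun x =>
      (expectedMessages_summationProtocol_le r hs ha hΔ x).trans (ENNReal.ofReal_le_ofReal ?_)⟩
  · have h1 : (Δ : ℝ) * ((1 - γ) * ε / Δ) = (1 - γ) * ε := by field_simp
    rw [h1, ← ht]
    nlinarith
  · rw [← ht]
    have h1 : 31 * (t + 1) * a ≤ ε₀ := by nlinarith
    have h2 : (1 + 2 * t) * Real.exp (-(1 + 2 * t)) ≤ 1 := by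
      calc (1 + 2 * t) * Real.exp (-(1 + 2 * t))
          ≤ Real.exp (1 + 2 * t) * Real.exp (-(1 + 2 * t)) := by
            gcongr; linarith [Real.add_one_le_exp (1 + 2 * t)]
        _ = 1 := by rw [← Real.exp_add]; simp
    have h3 : Real.exp (-L) = δ := by
      rw [hL, one_div, Real.log_inv, neg_neg, Real.exp_log hδ0]
    calc Real.exp (31 * (t + 1) * a) * ((1 + 2 * t) * Real.exp (-r))
        ≤ Real.exp ε₀ * ((1 + 2 * t) * Real.exp (-r)) := by gcongr
      _ = Real.exp ε₀ * Real.exp (-ε₀) * ((1 + 2 * t) * Real.exp (-(1 + 2 * t))) *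
          Real.exp (-L) := by
          rw [hrval, show -(ε₀ + (1 + 2 * t) + L) = -ε₀ + -(1 + 2 * t) + -L by ring,
            Real.exp_add, Real.exp_add]
          ring
      _ ≤ 1 * 1 * δ := by
          rw [h3, ← Real.exp_add, add_neg_cancel, Real.exp_zero]
          gcongr
      _ = δ := by ring
  · rw [← ht]
    have hr' : (r : ℝ) ≤ (2 * ε₀ + 9) * (Λ * L) := by
      have h1 : 1 ≤ 2 * L := by linarith
      have h2 : L ≤ Λ * L := by nlinarith
      have h3 : 1 ≤ 2 * (Λ * L) := by linarith
      have h4 : Λ ≤ 2 * (Λ * L) := by nlinarith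
      rw [hrval]
      nlinarith [mul_le_mul_of_nonneg_left h3 hε₀.le]
    have hK : 0 < Δ / (n * (γ * ε)) := by positivity
    have hcentral : 2 / (n * ((1 - γ) * ε / Δ)) ≤ 4 * (Λ ^ 3 * L * (Δ / (n * (γ * ε)))) := by
      have h1 : 1 / 2 ≤ Λ ^ 3 * L := by nlinarith [one_le_pow₀ hΛ1 (n := 3)]
      calc 2 / (n * ((1 - γ) * ε / Δ)) = 2 * (Δ / (n * ((1 - γ) * ε))) := by
            have : 1 - γ ≠ 0 := by linarith
            field_simp
        -- Here `γ < 1 / 2` enters, as `γ ≤ 1 - γ`.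
        _ ≤ 2 * (Δ / (n * (γ * ε))) := by gcongr; linarith
        _ ≤ _ := by nlinarith
    have hflood : 9 * Δ * (1 + t) * r / (n * a) ≤
        1152 * (1 + ε₀) * (2 * ε₀ + 9) * (Λ ^ 3 * L * (Δ / (n * (γ * ε)))) := by
      calc 9 * Δ * (1 + t) * r / (n * a)
          = 288 * (1 + ε₀) * (t + 1) ^ 2 * r * (Δ / (n * (γ * ε))) := by
            rw [hadef]; field_simp; ring
        _ ≤ 288 * (1 + ε₀) * (2 * Λ) ^ 2 * ((2 * ε₀ + 9) * (Λ * L)) * (Δ / (n * (γ * ε))) := by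
            gcongr
        _ = _ := by ring
    calc 1 + (2 / (n * ((1 - γ) * ε / Δ)) + 9 * Δ * (1 + t) * r / (n * a))
        ≤ 1 + (4 * (Λ ^ 3 * L * (Δ / (n * (γ * ε)))) +
          1152 * (1 + ε₀) * (2 * ε₀ + 9) * (Λ ^ 3 * L * (Δ / (n * (γ * ε))))) := by gcongr
      _ = _ := by rw [mul_comm (n : ℝ)]; ring
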